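/- Let $\mathcal T$ be the set of isomorphism classes of finite non-planar rooted trees, and let $\mathcal H_{\mathcal T}=\mathbb Q[\mathcal T]$ be the commutative polynomial algebra over $\mathbb Q$ generated by $\mathcal T$; its monomials are called forests. A subforest $F$ of a tree $T$ is a set of vertices of $T$ that contains all descendants of each of its elements, together with the edges of $T$ connecting these vertices; it is regarded as an element of $\mathcal H_{\mathcal T}$, namely the product of its connected components (the empty subforest is $1$). The quotient $T/F$ is the tree obtained from $T$ by removing $F$ and the edges connecting $F$ to the rest of $T$; in particular $T/\emptyset=T$, and $T/T=1$ by convention. Let $\Delta:\mathcal H_{\mathcal T}\to\mathcal H_{\mathcal T}\otimes\mathcal H_{\mathcal T}$ and $\varepsilon:\mathcal H_{\mathcal T}\to\mathbb Q$ be the $\mathbb Q$-algebra homomorphisms given on trees $T\in\mathcal T$ by $$\Delta(T)=\sum_{F}F\otimes (T/F),\qquad \varepsilon(T)=0,$$ where $F$ runs over all subforests of $T$, including the empty one and $T$ itself. For $n\ge 0$ let $\mathcal H_n$ be the span of the forests with $n$ vertices in total. Then $\mathcal H_{\mathcal T}$ is a connected graded Hopf algebra. That is, $(\mathcal H_{\mathcal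 T},\Delta,\varepsilon)$ is a bialgebra ($\Delta$ is coassociative and $\varepsilon$ is a counit for it) and has an antipode; moreover $\mathcal H_{\mathcal T}=\bigoplus_{n\ge 0}\mathcal H_n$, $\mathcal H_p\mathcal H_q\subseteq\mathcal H_{p+q}$ and $\Delta(\mathcal H_n)\subseteq\bigoplus_{p+q=n}\mathcal H_p\otimes\mathcal H_q$ for all $p,q,n\ge 0$, and $\mathcal H_0=\mathbb Q\cdot 1$. -/

import Mathlib

open scoped TensorProduct

noncomputable section

/-! ### Isomorphism classes of finite rooted trees

A rooted tree is Mathlib's `RootedTree`: the vertices carry the ancestor order, `x ≤ y` meaning that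
`y` is a descendant of `x` (or `y = x`), and the root is `⊥`. No order is chosen on the branches at
a vertex, so the trees are non-planar. -/

/-- Finite rooted trees. -/
abbrev FiniteRootedTree : Type 1 := {T : RootedTree.{0} // Finite T}

/-- Two finite rooted trees are isomorphic if there is a bijection of their vertices which preserves
the ancestor relation in both directions. -/
instance FiniteRootedTree.isoSetoid : Setoid FiniteRootedTree where
  r S T := Nonempty (S.1 ≃o T.1)
  iseqv :=
    { refl := fun _ => ⟨OrderIso.refl _⟩
      symm := fun ⟨e⟩ => ⟨e.symm⟩
      trans := fun ⟨e⟩ ⟨f⟩ => ⟨e.trans f⟩ }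

/-- The set of isomorphism classes of finite (non-planar) rooted trees. -/
def RootedTreeClass : Type 1 := Quotient FiniteRootedTree.isoSetoid

/-- The isomorphism class of a finite rooted tree. -/
def RootedTreeClass.mk (T : RootedTree.{0}) [hT : Finite T] : RootedTreeClass :=
  Quotient.mk FiniteRootedTree.isoSetoid ⟨T, hT⟩

theorem RootedTreeClass.mk_eq_of_orderIso {S T : RootedTree.{0}} [Finite S] [Finite T]
    (e : S ≃o T) : RootedTreeClass.mk S = RootedTreeClass.mk T :=
  Quotient.sound ⟨e⟩

/-- The number of vertices of a tree. -/
def RootedTreeClass.numVertices : RootedTreeClass → ℕ :=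
  Quotient.lift (fun T : FiniteRootedTree => Nat.card T.1) fun _ _ ⟨e⟩ => Nat.card_congr e.toEquiv

/-- The polynomial algebra `ℚ[𝒯]` on the set `𝒯` of rooted trees. Its monomials are the forests. -/
abbrev RootedTreeAlgebra : Type 1 := MvPolynomial RootedTreeClass ℚ

/-! ### Subforests and quotients

A subforest of `T` is a set of vertices that contains all descendants of its elements, that is,
an upper set for the ancestor order. -/

namespace RootedTree

/-- The tree obtained from `T` by removing the vertices of a subforest `F` that does not contain the
root, together with all edges that meet a vertex of `F`. -/
def prune (T : RootedTree.{0}) (F : UpperSet T) (hF : ⊥ ∉ F) : RootedTree.{0} :=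
  letI : SemilatticeInf ↥((F : Set T)ᶜ) :=
    Subtype.semilatticeInf fun {_ _} hx _ h => hx (F.upper inf_le_left h)
  letI : OrderBot ↥((F : Set T)ᶜ) := Subtype.orderBot hF
  haveI : ((F : Set T)ᶜ).OrdConnected := F.upper.compl.ordConnected
  { α := ↥((F : Set T)ᶜ) }

instance (T : RootedTree.{0}) [Finite T] (F : UpperSet T) (hF : ⊥ ∉ F) : Finite (T.prune F hF) :=
  inferInstanceAs (Finite ↥((F : Set T)ᶜ))

/-- The subforest `F` of `T` as a monomial: the product of its connected components. These are the
trees `{y | r ≤ y}` hanging from the minimal elements `r` of `F`; the empty subforest gives `1`. -/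
def subforestMonomial (T : RootedTree.{0}) [Finite T] (F : UpperSet T) : RootedTreeAlgebra :=
  ∏ᶠ r : {r : T // Minimal (· ∈ F) r},
    MvPolynomial.X (RootedTreeClass.mk (T.subtree r.1 : RootedTree.{0}))

open Classical in
/-- The quotient `T/F`, as an element of the polynomial algebra. The subforest `F` is all of `T`
exactly if it contains the root, and then `T/F = 1`. -/
def quotientMonomial (T : RootedTree.{0}) [Finite T] (F : UpperSet T) : RootedTreeAlgebra :=
  if hF : ⊥ ∈ F then 1 else MvPolynomial.X (RootedTreeClass.mk (T.prune F hF))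

/-- `Δ(T) = ∑ F ⊗ T/F`, the (finite) sum being over all subforests `F` of `T`, including the empty
and the full one. -/
def coproduct (T : RootedTree.{0}) [Finite T] : RootedTreeAlgebra ⊗[ℚ] RootedTreeAlgebra :=
  ∑ᶠ F : UpperSet T, T.subforestMonomial F ⊗ₜ[ℚ] T.quotientMonomial F

/-! The coproduct of a tree depends only on its isomorphism class. -/

theorem subforestMonomial_map {S T : RootedTree.{0}} [Finite S] [Finite T] (e : S ≃o T)
    (F : UpperSet S) :
    T.subforestMonomial (UpperSet.map e F) = S.subforestMonomial F := by
  have hmem : ∀ x : S, e x ∈ UpperSet.map e F ↔ x ∈ F := fun x => by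
    simp [UpperSet.mem_map]
  have hmin : ∀ r : S, Minimal (· ∈ F) r ↔ Minimal (· ∈ UpperSet.map e F) (e r) := fun r => by
    constructor
    · rintro ⟨h1, h2⟩
      refine ⟨(hmem r).2 h1, fun y hy hyr => ?_⟩
      obtain ⟨x, rfl⟩ := e.surjective y
      exact e.le_iff_le.2 (h2 ((hmem x).1 hy) (e.le_iff_le.1 hyr))
    · rintro ⟨h1, h2⟩
      exact ⟨(hmem r).1 h1, fun y hy hyr =>
        e.le_iff_le.1 (h2 ((hmem y).2 hy) (e.le_iff_le.2 hyr))⟩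
  let g : {r : S // Minimal (· ∈ F) r} ≃ {r : T // Minimal (· ∈ UpperSet.map e F) r} :=
    e.toEquiv.subtypeEquiv hmin
  refine (finprod_comp_equiv g).symm.trans (finprod_congr fun r => ?_)
  refine congrArg MvPolynomial.X (RootedTreeClass.mk_eq_of_orderIso ?_)
  exact
    { toEquiv := (e.toEquiv.subtypeEquiv fun _ => (e.le_iff_le).symm).symm
      map_rel_iff' := fun {a b} => e.symm.le_iff_le (x := a.1) (y := b.1) }

theorem quotientMonomial_map {S T : RootedTree.{0}} [Finite S] [Finite T] (e : S ≃o T)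
    (F : UpperSet S) :
    T.quotientMonomial (UpperSet.map e F) = S.quotientMonomial F := by
  have hmem : ∀ x : S, e x ∈ UpperSet.map e F ↔ x ∈ F := fun x => by
    simp [UpperSet.mem_map]
  have hbot : ⊥ ∈ UpperSet.map e F ↔ ⊥ ∈ F := by
    rw [← hmem ⊥, e.map_bot]
  unfold quotientMonomial
  by_cases h : ⊥ ∈ F
  · rw [dif_pos h, dif_pos (hbot.2 h)]
  · rw [dif_neg h, dif_neg (fun h' => h (hbot.1 h'))]
    refine congrArg MvPolynomial.X (RootedTreeClass.mk_eq_of_orderIso ?_)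
    exact
      { toEquiv := (e.toEquiv.subtypeEquiv fun x => not_congr (hmem x).symm).symm
        map_rel_iff' := fun {a b} => e.symm.le_iff_le (x := a.1) (y := b.1) }

theorem coproduct_eq_of_orderIso {S T : RootedTree.{0}} [Finite S] [Finite T] (e : S ≃o T) :
    S.coproduct = T.coproduct := by
  unfold coproduct
  rw [← finsum_comp_equiv (UpperSet.map e).toEquiv]
  refine finsum_congr fun F => ?_
  change _ = T.subforestMonomial (UpperSet.map e F) ⊗ₜ T.quotientMonomial (UpperSet.map e F)
  rw [subforestMonomial_map, quotientMonomial_map]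

end RootedTree

/-! ### The structure maps and the grading -/

/-- `RootedTree.coproduct` on isomorphism classes. -/
def RootedTreeClass.coproduct : RootedTreeClass → RootedTreeAlgebra ⊗[ℚ] RootedTreeAlgebra :=
  Quotient.lift (fun T : FiniteRootedTree => haveI := T.2; T.1.coproduct)
    fun S T ⟨e⟩ => haveI := S.2; haveI := T.2; RootedTree.coproduct_eq_of_orderIso e

namespace RootedTreeAlgebra

/-- The coproduct `Δ`: the algebra homomorphism given on a tree by `Δ(T) = ∑ F ⊗ T/F`. -/
def comul : RootedTreeAlgebra →ₐ[ℚ] RootedTreeAlgebra ⊗[ℚ] RootedTreeAlgebra :=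
  MvPolynomial.aeval RootedTreeClass.coproduct

/-- The counit `ε`: the algebra homomorphism which is zero on every tree. -/
def counit : RootedTreeAlgebra →ₐ[ℚ] ℚ :=
  MvPolynomial.aeval fun _ => 0

/-- The span of the forests with `n` vertices. -/
def degree (n : ℕ) : Submodule ℚ RootedTreeAlgebra :=
  MvPolynomial.weightedHomogeneousSubmodule ℚ RootedTreeClass.numVertices n

end RootedTreeAlgebra

/-- The submodules `𝒜 n` are a connected grading of an algebra `A` with coproduct `Δ`:
`A = ⨁ 𝒜 n`, `𝒜 p * 𝒜 q ⊆ 𝒜 (p + q)`, `Δ (𝒜 n) ⊆ ⨁_{p + q = n} 𝒜 p ⊗ 𝒜 q`, and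
`𝒜 0` is the image of the unit map. -/
structure IsConnectedGrading {R A : Type*} [CommRing R] [Ring A] [Algebra R A]
    (Δ : A →ₐ[R] A ⊗[R] A) (𝒜 : ℕ → Submodule R A) : Prop where
  isInternal : DirectSum.IsInternal 𝒜
  mul_mem : ∀ p q : ℕ, ∀ a ∈ 𝒜 p, ∀ b ∈ 𝒜 q, a * b ∈ 𝒜 (p + q)
  comul_mem : ∀ n : ℕ, ∀ a ∈ 𝒜 n,
    Δ a ∈ ⨆ (p : ℕ) (q : ℕ) (_ : p + q = n), LinearMap.range (TensorProduct.mapIncl (𝒜 p) (𝒜 q))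
  zero_eq : 𝒜 0 = LinearMap.range (Algebra.linearMap R A)

end

/-! All computations take place inside one tree `T`. A finite set `S` of its vertices, with the
induced order, is again a forest, since the elements below a given one form a chain. Its monomial is
`forestMonomial S`. A subforest, the quotient by it, and all further subforests and quotients of
these are sets of vertices of the same `T`, so iterated cuts become set operations and no
isomorphisms have to be tracked.

The key formula is `comul_forestMonomial`: `Δ` of the forest on `S` is the sum of `U ⊗ (S \ U)` over
the upper sets `U` of `S`. It extends the definition from trees to forests because both sides are
multiplicative over unions of mutually incomparable sets.

All identities between algebra homomorphisms are checked on trees. Coassociativity then says that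
both iterated coproducts sum over the ways to cut `T` twice (`sum_subforests_subforests`), and the
counit leaves only the empty or the full cut. The polynomial algebra is free on the trees, so a left
and a right convolution inverse of the identity can be defined tree by tree, by recursion on the
number of vertices; they coincide and give the antipode. The grading is preserved because a cut
splits the vertex set, and it is connected because every tree has a vertex. -/

noncomputable section

/-! ### Forests induced on finite sets of vertices -/

namespace RootedTree

/-- A finite partial order with a bottom in which the elements below any element form a chain,
as a rooted tree. -/
def ofForestOrder (α : Type) [PartialOrder α] [OrderBot α] [Finite α]
    (h : ∀ x y z : α, x ≤ z → y ≤ z → x ≤ y ∨ y ≤ x) : RootedTree.{0} :=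
  -- A set bounded above is a chain by `h`, so a maximal element of it is greatest. This yields both
  -- meets and parents.
  have greatest : ∀ s : Set α, s.Nonempty → (∃ z, ∀ x ∈ s, x ≤ z) → ∃ m, IsGreatest s m := by
    rintro s hs ⟨z, hz⟩
    obtain ⟨m, hm⟩ := s.toFinite.exists_maximal hs
    refine ⟨m, hm.1, fun x hx => ?_⟩
    rcases h x m z (hz x hx) (hz m hm.1) with h' | h'
    · exact h'
    · exact hm.2 hx h'
  have glb : ∀ x y : α, ∃ m, IsGreatest {z | z ≤ x ∧ z ≤ y} m := fun x y =>
    greatest _ ⟨⊥, bot_le, bot_le⟩ ⟨x, fun _ hz => hz.1⟩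
  have parent : ∀ x : α, ∃ m, m ≤ x ∧ (x ≤ m → IsMin x) ∧ ∀ y, y < x → y ≤ m := fun x => by
    by_cases hx : x = ⊥
    -- The root has no parent and is its own predecessor.
    · exact ⟨⊥, bot_le, fun _ => hx ▸ isMin_bot, fun y hy => absurd (hx ▸ hy) not_lt_bot⟩
    · obtain ⟨m, hm, hm'⟩ := greatest {z | z < x} ⟨⊥, bot_lt_iff_ne_bot.2 hx⟩ ⟨x, fun _ hz => hz.le⟩
      exact ⟨m, le_of_lt hm, fun hxm => absurd hm hxm.not_gt, fun y hy => hm' hy⟩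
  letI : SemilatticeInf α :=
    { (inferInstance : PartialOrder α) with
      inf := fun x y => (glb x y).choose
      inf_le_left := fun x y => (glb x y).choose_spec.1.1
      inf_le_right := fun x y => (glb x y).choose_spec.1.2
      le_inf := fun _ y z hy hz => (glb y z).choose_spec.2 ⟨hy, hz⟩ }
  letI : PredOrder α :=
    { pred := fun x => (parent x).choose
      pred_le := fun x => (parent x).choose_spec.1
      min_of_le_pred := fun {x} => (parent x).choose_spec.2.1
      le_pred_of_lt := fun {y x} hy => (parent x).choose_spec.2.2 y hy }
  haveI : IsPredArchimedean α := inferInstance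
  { α := α }

/-- The vertices of `ofForestOrder α h` are the elements of `α`. -/
def ofForestOrderIso (α : Type) [PartialOrder α] [OrderBot α] [Finite α]
    (h : ∀ x y z : α, x ≤ z → y ≤ z → x ≤ y ∨ y ≤ x) : ofForestOrder α h ≃o α where
  toEquiv := Equiv.refl α
  map_rel_iff' := Iff.rfl

instance (α : Type) [PartialOrder α] [OrderBot α] [Finite α]
    (h : ∀ x y z : α, x ≤ z → y ≤ z → x ≤ y ∨ y ≤ x) : Finite (ofForestOrder α h) :=
  Finite.of_equiv α (ofForestOrderIso α h).symm.toEquiv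

/-- The vertex `r` together with the vertices of `S` above it. -/
abbrev BranchVertex {T : RootedTree.{0}} (S : Finset T) (r : T) : Type :=
  {y : T // y = r ∨ r ≤ y ∧ y ∈ S}

instance {T : RootedTree.{0}} (S : Finset T) (r : T) : OrderBot (BranchVertex S r) where
  bot := ⟨r, Or.inl rfl⟩
  bot_le := fun y => Subtype.mk_le_mk.2 (y.2.elim (fun h => h.ge) fun h => h.1)

instance {T : RootedTree.{0}} (S : Finset T) (r : T) : Finite (BranchVertex S r) :=
  ((S.finite_toSet.insert r).subset fun _ hy => hy.imp_right And.right).to_subtype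

variable {T T' : RootedTree.{0}}

/-- The tree formed by `r` and the vertices of `S` above it. -/
def branch (S : Finset T) (r : T) : RootedTree.{0} :=
  ofForestOrder (BranchVertex S r) fun x y z hx hy =>
    (le_total_of_directed (r := (z : T)) (v₁ := (x : T)) (v₂ := (y : T)) hx hy).symm

instance (S : Finset T) (r : T) : Finite (branch S r) :=
  inferInstanceAs (Finite (ofForestOrder _ _))

/-- The vertices of `branch S r`. -/
def branchIso (S : Finset T) (r : T) : branch S r ≃o BranchVertex S r :=
  ofForestOrderIso _ _

theorem mk_branch_eq {S : Finset T} {r : T} {Q : RootedTree.{0}} [Finite Q]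
    (e : BranchVertex S r ≃o Q) : RootedTreeClass.mk (branch S r) = RootedTreeClass.mk Q :=
  RootedTreeClass.mk_eq_of_orderIso ((branchIso S r).trans e)

theorem mk_branch_congr {S R : Finset T} {r : T} (h : ∀ y, r ≤ y → (y ∈ S ↔ y ∈ R)) :
    RootedTreeClass.mk (branch S r) = RootedTreeClass.mk (branch R r) :=
  mk_branch_eq <| OrderIso.trans (β := BranchVertex R r)
    { toEquiv := Equiv.subtypeEquivRight fun y =>
        or_congr_right (and_congr_right fun hy => h y hy)
      map_rel_iff' := Iff.rfl } (branchIso R r).symm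

theorem mk_branch_map (f : T' ↪o T) (S : Finset T') (r : T') :
    RootedTreeClass.mk (branch (S.map f.toEmbedding) (f r)) =
      RootedTreeClass.mk (branch S r) := by
  have hf : ∀ y : BranchVertex S r,
      f y = f r ∨ f r ≤ f y ∧ f y ∈ S.map f.toEmbedding := fun y =>
    y.2.imp (congrArg f) fun h => ⟨f.le_iff_le.2 h.1, Finset.mem_map_of_mem _ h.2⟩
  let g : BranchVertex S r ↪o BranchVertex (S.map f.toEmbedding) (f r) :=
    OrderEmbedding.ofMapLEIff (fun y => ⟨f y, hf y⟩) fun _ _ => f.le_iff_le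
  have hg : Function.Surjective g := by
    rintro ⟨z, rfl | ⟨hz, hzS⟩⟩
    · exact ⟨⟨r, Or.inl rfl⟩, rfl⟩
    · obtain ⟨y, hy, rfl⟩ := Finset.mem_map.1 hzS
      exact ⟨⟨y, Or.inr ⟨f.le_iff_le.1 hz, hy⟩⟩, rfl⟩
  exact (mk_branch_eq ((RelIso.ofSurjective g hg).trans (branchIso _ _).symm)).symm

open Classical in
/-- The forest induced on the vertex set `S`, as a monomial. -/
def forestMonomial (S : Finset T) : RootedTreeAlgebra :=
  ∏ r ∈ S with Minimal (· ∈ S) r, MvPolynomial.X (RootedTreeClass.mk (branch S r))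

@[simp]
theorem forestMonomial_empty : forestMonomial (∅ : Finset T) = 1 := by
  simp [forestMonomial]

-- Without relations between `S` and `R`, the minimal elements of the union are those of the two
-- parts, and each branch stays within its part.
open Classical in
theorem forestMonomial_union {S R : Finset T}
    (h : ∀ x ∈ S, ∀ y ∈ R, ¬x ≤ y ∧ ¬y ≤ x) :
    forestMonomial (S ∪ R) = forestMonomial S * forestMonomial R := by
  have hd : Disjoint S R := Finset.disjoint_left.2 fun x hx hx' => (h x hx x hx').1 le_rfl
  unfold forestMonomial
  rw [Finset.filter_union, Finset.prod_union (Finset.disjoint_filter_filter hd)]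
  congr 1
  · refine Finset.prod_congr (Finset.filter_congr fun x hx => ?_) fun x hx => ?_
    · refine ⟨fun hm => ⟨hx, fun y hy hyx => hm.2 (Finset.mem_union_left _ hy) hyx⟩,
        fun hm => ⟨Finset.mem_union_left _ hx, fun y hy hyx => ?_⟩⟩
      rcases Finset.mem_union.1 hy with hy | hy
      · exact hm.2 hy hyx
      · exact absurd hyx (h x hx y hy).2
    · refine congrArg MvPolynomial.X (mk_branch_congr fun y hy => ?_)
      rw [Finset.mem_union, or_iff_left]
      exact fun hyR => (h x (Finset.mem_filter.1 hx).1 y hyR).1 hy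
  · refine Finset.prod_congr (Finset.filter_congr fun x hx => ?_) fun x hx => ?_
    · refine ⟨fun hm => ⟨hx, fun y hy hyx => hm.2 (Finset.mem_union_right _ hy) hyx⟩,
        fun hm => ⟨Finset.mem_union_right _ hx, fun y hy hyx => ?_⟩⟩
      rcases Finset.mem_union.1 hy with hy | hy
      · exact absurd hyx (h y hy x hx).1
      · exact hm.2 hy hyx
    · refine congrArg MvPolynomial.X (mk_branch_congr fun y hy => ?_)
      rw [Finset.mem_union, or_iff_right]
      exact fun hyS => (h y hyS x (Finset.mem_filter.1 hx).1).2 hy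

theorem forestMonomial_map (f : T' ↪o T) (S : Finset T') :
    forestMonomial (S.map f.toEmbedding) = forestMonomial S := by
  classical
  unfold forestMonomial
  rw [Finset.filter_map, Finset.prod_map]
  refine Finset.prod_congr (Finset.filter_congr fun x hx => ?_) fun x hx =>
    congrArg MvPolynomial.X (mk_branch_map f S x)
  simp only [Function.comp_apply, Minimal, Finset.mem_map, RelEmbedding.coe_toEmbedding]
  constructor
  · exact fun hm => ⟨hx, fun y hy hyx => f.le_iff_le.1 (hm.2 ⟨y, hy, rfl⟩ (f.le_iff_le.2 hyx))⟩
  · rintro hm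
    refine ⟨⟨x, hx, rfl⟩, ?_⟩
    rintro _ ⟨y, hy, rfl⟩ hyx
    exact f.le_iff_le.2 (hm.2 hy (f.le_iff_le.1 hyx))

theorem forestMonomial_of_isLeast {S : Finset T} {r : T} (h : IsLeast (S : Set T) r) :
    forestMonomial S = MvPolynomial.X (RootedTreeClass.mk (branch S r)) := by
  classical
  unfold forestMonomial
  rw [Finset.prod_eq_single_of_mem r]
  · exact Finset.mem_filter.2 ⟨h.1, h.1, fun y hy _ => h.2 hy⟩
  · intro x hx hxr
    have hx := (Finset.mem_filter.1 hx).2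
    exact absurd (le_antisymm (hx.2 h.1 (h.2 hx.1)) (h.2 hx.1)) hxr

theorem forestMonomial_univ [Fintype T] :
    forestMonomial (Finset.univ : Finset T) = MvPolynomial.X (RootedTreeClass.mk T) := by
  rw [forestMonomial_of_isLeast (r := ⊥) ⟨by simp, fun _ _ => bot_le⟩]
  refine congrArg MvPolynomial.X (mk_branch_eq ?_)
  exact
    { toEquiv := Equiv.subtypeUnivEquiv fun y => Or.inr ⟨bot_le, Finset.mem_univ y⟩
      map_rel_iff' := Iff.rfl }

-- As `F` is an upper set, the branch of `F` at a minimal `r` is the full subtree of descendants of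
-- `r`.
open Classical in
theorem subforestMonomial_eq [Fintype T] (F : UpperSet T) :
    T.subforestMonomial F = forestMonomial {x | x ∈ F} := by
  unfold subforestMonomial forestMonomial
  rw [finprod_eq_prod_of_fintype, ← Finset.prod_subtype
    (Finset.univ.filter fun r : T => Minimal (· ∈ F) r) (by simp)
    fun r => (MvPolynomial.X (RootedTreeClass.mk (T.subtree r : RootedTree.{0})) :
      RootedTreeAlgebra)]
  refine Finset.prod_congr ?_ fun r hr => congrArg MvPolynomial.X (mk_branch_eq ?_).symm
  · ext r
    simp only [Finset.mem_filter, Finset.mem_univ, true_and]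
    exact ⟨fun h => ⟨h.1, h⟩, fun h => h.2⟩
  · have hr : r ∈ F := by simpa using ((Finset.mem_filter.1 hr).2).1
    exact
      { toEquiv := Equiv.subtypeEquivRight fun y => by
          simp only [Finset.mem_filter, Finset.mem_univ, true_and]
          exact ⟨fun h => h.elim (fun h => h.ge) fun h => h.1,
            fun h => Or.inr ⟨h, F.upper h hr⟩⟩
        map_rel_iff' := Iff.rfl }

-- The convention `T/T = 1` agrees with the empty product; otherwise the root is the least element
-- of the complement.
open Classical in
theorem quotientMonomial_eq [Fintype T] (F : UpperSet T) :
    T.quotientMonomial F = forestMonomial {x | x ∉ F} := by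
  unfold quotientMonomial
  split_ifs with hF
  · rw [Finset.filter_false_of_mem, forestMonomial_empty]
    exact fun x _ hx => hx (F.upper bot_le hF)
  · rw [forestMonomial_of_isLeast (r := ⊥) ⟨by simpa using hF, fun _ _ => bot_le⟩]
    refine congrArg MvPolynomial.X (mk_branch_eq ?_).symm
    exact
      { toEquiv := Equiv.subtypeEquivRight fun y => by
          simp only [Finset.mem_filter, Finset.mem_univ, true_and]
          exact ⟨fun h => h.elim (fun h => h ▸ hF) fun h => h.2, fun h => Or.inr ⟨bot_le, h⟩⟩
        map_rel_iff' := Iff.rfl }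

end RootedTree

/-! ### The coproduct of an induced forest -/

namespace RootedTree

variable {T T' : RootedTree.{0}}

open Classical in
/-- The subsets of `S` that are upper sets for the order induced on `S`. -/
def subforests (S : Finset T) : Finset (Finset T) :=
  {U ∈ S.powerset | ∀ x ∈ U, ∀ y ∈ S, x ≤ y → y ∈ U}

theorem mem_subforests {S U : Finset T} :
    U ∈ subforests S ↔ U ⊆ S ∧ ∀ x ∈ U, ∀ y ∈ S, x ≤ y → y ∈ U := by
  simp [subforests]

open Classical in
/-- The sum of `U ⊗ S/U` over all subforests `U` of the forest induced on `S`. -/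
def forestCoproduct (S : Finset T) : RootedTreeAlgebra ⊗[ℚ] RootedTreeAlgebra :=
  ∑ U ∈ subforests S, forestMonomial U ⊗ₜ[ℚ] forestMonomial (S \ U)

theorem coproduct_eq [Fintype T] : T.coproduct = forestCoproduct (Finset.univ : Finset T) := by
  classical
  have : Fintype (UpperSet T) := Fintype.ofFinite _
  unfold coproduct forestCoproduct
  rw [finsum_eq_sum_of_fintype]
  refine Finset.sum_bij (fun F _ => ({x | x ∈ F} : Finset T)) ?_ ?_ ?_ ?_
  · intro F _
    refine mem_subforests.2 ⟨Finset.subset_univ _, fun x hx y _ hxy => ?_⟩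
    simp only [Finset.mem_filter, Finset.mem_univ, true_and] at hx ⊢
    exact F.upper hxy hx
  · intro F _ G _ h
    ext x
    simpa using Finset.ext_iff.1 h x
  · intro U hU
    exact ⟨⟨U, fun x y hxy hx => (mem_subforests.1 hU).2 x hx y (Finset.mem_univ y) hxy⟩,
      Finset.mem_univ _, by
        ext
        simp only [Finset.mem_filter, Finset.mem_univ, true_and]
        exact Iff.rfl⟩
  · intro F _
    rw [subforestMonomial_eq, quotientMonomial_eq]
    congr 2
    ext
    simp

theorem forestCoproduct_map (f : T' ↪o T) (S : Finset T') :
    forestCoproduct (S.map f.toEmbedding) = forestCoproduct S := by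
  classical
  unfold forestCoproduct
  symm
  refine Finset.sum_bij (fun U _ => U.map f.toEmbedding) ?_ ?_ ?_ ?_
  · intro U hU
    obtain ⟨hUS, hU⟩ := mem_subforests.1 hU
    refine mem_subforests.2 ⟨Finset.map_subset_map.2 hUS, ?_⟩
    simp only [Finset.mem_map, RelEmbedding.coe_toEmbedding]
    rintro _ ⟨x, hx, rfl⟩ _ ⟨y, hy, rfl⟩ hxy
    exact ⟨y, hU x hx y hy (f.le_iff_le.1 hxy), rfl⟩
  · exact fun U _ V _ h => Finset.map_injective _ h
  · intro V hV
    obtain ⟨hVS, hV⟩ := mem_subforests.1 hV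
    obtain ⟨U, hUS, rfl⟩ := Finset.subset_map_iff.1 hVS
    refine ⟨U, mem_subforests.2 ⟨hUS, fun x hx y hy hxy => ?_⟩, rfl⟩
    exact (Finset.mem_map' _).1 (hV (f x) (Finset.mem_map_of_mem _ hx) (f y)
      (Finset.mem_map_of_mem _ hy) (f.le_iff_le.2 hxy))
  · intro U _
    rw [← Finset.map_sdiff, forestMonomial_map, forestMonomial_map]

-- A subforest of the union is a pair of subforests, one of each part, and its complement splits in
-- the same way.
open Classical in
theorem forestCoproduct_union {S R : Finset T}
    (h : ∀ x ∈ S, ∀ y ∈ R, ¬x ≤ y ∧ ¬y ≤ x) :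
    forestCoproduct (S ∪ R) = forestCoproduct S * forestCoproduct R := by
  have hd : Disjoint S R := Finset.disjoint_left.2 fun x hx hx' => (h x hx x hx').1 le_rfl
  unfold forestCoproduct
  rw [Finset.sum_mul_sum, ← Finset.sum_product']
  symm
  refine Finset.sum_bij' (fun p _ => p.1 ∪ p.2) (fun U _ => (U ∩ S, U ∩ R)) ?_ ?_ ?_ ?_ ?_
  · rintro ⟨U, V⟩ hUV
    obtain ⟨hU, hV⟩ := Finset.mem_product.1 hUV
    obtain ⟨hUS, hU⟩ := mem_subforests.1 hU
    obtain ⟨hVR, hV⟩ := mem_subforests.1 hV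
    refine mem_subforests.2 ⟨Finset.union_subset_union hUS hVR, fun x hx y hy hxy => ?_⟩
    simp only [Finset.mem_union] at hx hy ⊢
    rcases hx with hx | hx <;> rcases hy with hy | hy
    · exact Or.inl (hU x hx y hy hxy)
    · exact absurd hxy (h x (hUS hx) y hy).1
    · exact absurd hxy (h y hy x (hVR hx)).2
    · exact Or.inr (hV x hx y hy hxy)
  · intro U hU
    obtain ⟨_, hU⟩ := mem_subforests.1 hU
    refine Finset.mem_product.2 ⟨mem_subforests.2 ⟨Finset.inter_subset_right, ?_⟩,
      mem_subforests.2 ⟨Finset.inter_subset_right, ?_⟩⟩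
    · exact fun x hx y hy hxy => Finset.mem_inter.2 ⟨hU x (Finset.mem_inter.1 hx).1 y
        (Finset.mem_union_left _ hy) hxy, hy⟩
    · exact fun x hx y hy hxy => Finset.mem_inter.2 ⟨hU x (Finset.mem_inter.1 hx).1 y
        (Finset.mem_union_right _ hy) hxy, hy⟩
  · rintro ⟨U, V⟩ hUV
    obtain ⟨hU, hV⟩ := Finset.mem_product.1 hUV
    have hU := (mem_subforests.1 hU).1
    have hV := (mem_subforests.1 hV).1
    have h1 : ∀ x ∈ S, x ∉ R := fun x hx => Finset.disjoint_left.1 hd hx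
    ext x <;> simp only [Finset.mem_inter, Finset.mem_union]
    · have := @hU x; have := @hV x; have := h1 x; tauto
    · have := @hU x; have := @hV x; have := h1 x; tauto
  · intro U hU
    rw [← Finset.inter_union_distrib_left, Finset.inter_eq_left]
    exact (mem_subforests.1 hU).1
  · rintro ⟨U, V⟩ hUV
    obtain ⟨hU, hV⟩ := Finset.mem_product.1 hUV
    have hU := (mem_subforests.1 hU).1
    have hV := (mem_subforests.1 hV).1
    have hsd : (S ∪ R) \ (U ∪ V) = S \ U ∪ R \ V := by
      have h1 : ∀ x ∈ S, x ∉ R := fun x hx => Finset.disjoint_left.1 hd hx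
      ext x
      simp only [Finset.mem_sdiff, Finset.mem_union]
      have := @hU x; have := @hV x; have := h1 x; tauto
    dsimp only
    rw [hsd, Algebra.TensorProduct.tmul_mul_tmul,
      forestMonomial_union fun x hx y hy => h x (hU hx) y (hV hy),
      forestMonomial_union fun x hx y hy =>
        h x (Finset.sdiff_subset hx) y (Finset.sdiff_subset hy)]

theorem comul_X_mk [Fintype T] : RootedTreeAlgebra.comul (MvPolynomial.X (RootedTreeClass.mk T)) =
    forestCoproduct (Finset.univ : Finset T) :=
  (MvPolynomial.aeval_X _ _).trans coproduct_eq

/-- The abstract tree `branch S r` embeds in `T` with image `S`, so its subforests can be computed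
inside `T`. -/
theorem comul_X_mk_branch {S : Finset T} {r : T} (h : IsLeast (S : Set T) r) :
    RootedTreeAlgebra.comul (MvPolynomial.X (RootedTreeClass.mk (branch S r))) =
      forestCoproduct S := by
  have : Fintype (branch S r) := Fintype.ofFinite _
  let f : branch S r ↪o T := (branchIso S r).toOrderEmbedding.trans (OrderEmbedding.subtype _)
  have hf : Finset.univ.map f.toEmbedding = S := by
    ext y
    simp only [Finset.mem_map, Finset.mem_univ, true_and, RelEmbedding.coe_toEmbedding]
    constructor
    · rintro ⟨x, rfl⟩
      exact ((branchIso S r) x).2.elim (fun h' => Set.mem_of_eq_of_mem h' h.1) fun h' => h'.2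
    · exact fun hy => ⟨(branchIso S r).symm ⟨y, Or.inr ⟨h.2 hy, hy⟩⟩, by simp [f]⟩
  rw [comul_X_mk, ← forestCoproduct_map f, hf]

theorem subforests_empty : subforests (∅ : Finset T) = {∅} := by
  ext U
  simp [mem_subforests]

/-- Splitting off one connected component, the part of `S` above a minimal `r`, drives the
inductions over forests. -/
theorem exists_union_isLeast {S : Finset T} (hS : S.Nonempty) : ∃ (r : T) (A B : Finset T),
    IsLeast (A : Set T) r ∧ (∀ x ∈ A, ∀ y ∈ B, ¬x ≤ y ∧ ¬y ≤ x) ∧ B ⊂ S ∧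
      S = (open Classical in A ∪ B) := by
  classical
  obtain ⟨r, hr⟩ := S.exists_minimal hS
  refine ⟨r, {y ∈ S | r ≤ y}, {y ∈ S | ¬ r ≤ y}, ⟨by simpa using hr.1, ?_⟩, ?_, ?_, ?_⟩
  · intro y hy
    simpa using (Finset.mem_filter.1 hy).2
  · intro x hx y hy
    have hx := (Finset.mem_filter.1 hx).2
    obtain ⟨hyS, hy⟩ := Finset.mem_filter.1 hy
    refine ⟨fun hxy => hy (hx.trans hxy), fun hyx => ?_⟩
    -- Both `y` and `r` lie below `x`, hence are comparable, and minimality of `r` leaves only `r ≤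
    -- y`.
    exact hy ((le_total_of_directed hyx hx).elim id fun h => hr.2 hyS h)
  · exact Finset.filter_ssubset.2 ⟨r, hr.1, by simp⟩
  · exact (Finset.filter_union_filter_not_eq _ _).symm

theorem comul_forestMonomial (S : Finset T) :
    RootedTreeAlgebra.comul (forestMonomial S) = forestCoproduct S := by
  classical
  induction S using Finset.strongInduction with
  | H S ih =>
    rcases S.eq_empty_or_nonempty with rfl | hS
    · simp [forestCoproduct, subforests_empty, Algebra.TensorProduct.one_def]
    · obtain ⟨r, A, B, hA, hAB, hB, rfl⟩ := exists_union_isLeast hS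
      rw [forestMonomial_union hAB, map_mul, ih B hB, forestMonomial_of_isLeast hA,
        comul_X_mk_branch hA, forestCoproduct_union hAB]

end RootedTree

/-! ### Recursion along a weight, and antipodes from convolution inverses -/

/-- A function can be defined by recursion along a weight `w` if its value at `t` depends only on
its values at the elements of smaller weight. -/
theorem exists_fixedPoint_of_local {σ β : Type*} [Zero β] (w : σ → ℕ) (Φ : (σ → β) → σ → β)
    (hΦ : ∀ f g t, (∀ s, w s < w t → f s = g s) → Φ f t = Φ g t) : ∃ f, ∀ t, f t = Φ f t := by
  classical
  let f : σ → β := (measure w).wf.fix fun t ih =>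
    Φ (fun s => if h : w s < w t then ih s h else 0) t
  refine ⟨f, fun t => ?_⟩
  refine ((measure w).wf.fix_eq _ t).trans (hΦ _ _ _ fun s hs => ?_)
  exact dif_pos hs

/-- A left and a right convolution inverse of the identity of a bialgebra agree, and are an
antipode. -/
theorem Bialgebra.exists_hopfAlgebra {R A : Type*} [CommRing R] [Ring A] (B : Bialgebra R A)
    (l r : A →ₗ[R] A)
    (hl : LinearMap.mul' R A ∘ₗ l.rTensor A ∘ₗ Coalgebra.comul =
      Algebra.linearMap R A ∘ₗ Coalgebra.counit)
    (hr : LinearMap.mul' R A ∘ₗ r.lTensor A ∘ₗ Coalgebra.comul =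
      Algebra.linearMap R A ∘ₗ Coalgebra.counit) :
    ∃ H : HopfAlgebra R A, H.toHopfAlgebraStruct.toBialgebra = B := by
  have hlr : l = r := WithConv.toConv_injective <|
    left_inv_eq_right_inv (a := WithConv.toConv (LinearMap.id : A →ₗ[R] A))
      (congrArg WithConv.toConv hl) (congrArg WithConv.toConv hr)
  subst hlr
  exact ⟨{ antipode := l, mul_antipode_rTensor_comul := hl, mul_antipode_lTensor_comul := hr }, rfl⟩

/-- A commutative bialgebra is a Hopf algebra as soon as the identity has a left and a right
convolution inverse among the algebra endomorphisms. -/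
theorem Bialgebra.exists_hopfAlgebra_ofAlgHom {R A : Type*} [CommRing R] [CommRing A] [Algebra R A]
    (Δ : A →ₐ[R] A ⊗[R] A) (ε : A →ₐ[R] R)
    (h_coassoc : (Algebra.TensorProduct.assoc R R R A A A).toAlgHom.comp
      ((Algebra.TensorProduct.map Δ (.id R A)).comp Δ) =
        (Algebra.TensorProduct.map (.id R A) Δ).comp Δ)
    (h_left : (Algebra.TensorProduct.map ε (.id R A)).comp Δ =
      (Algebra.TensorProduct.lid R A).symm)
    (h_right : (Algebra.TensorProduct.map (.id R A) ε).comp Δ =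
      (Algebra.TensorProduct.rid R R A).symm)
    (l r : A →ₐ[R] A)
    (hl : (Algebra.TensorProduct.productMap l (.id R A)).comp Δ = (Algebra.ofId R A).comp ε)
    (hr : (Algebra.TensorProduct.productMap (.id R A) r).comp Δ = (Algebra.ofId R A).comp ε) :
    ∃ H : HopfAlgebra R A, H.toHopfAlgebraStruct.toBialgebra =
      Bialgebra.ofAlgHom Δ ε h_coassoc h_left h_right := by
  refine Bialgebra.exists_hopfAlgebra (Bialgebra.ofAlgHom Δ ε h_coassoc h_left h_right)
    l.toLinearMap r.toLinearMap ?_ ?_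
  · have h : LinearMap.mul' R A ∘ₗ l.toLinearMap.rTensor A =
        (Algebra.TensorProduct.productMap l (.id R A)).toLinearMap :=
      TensorProduct.ext' fun _ _ => rfl
    exact (congrArg (· ∘ₗ Δ.toLinearMap) h).trans (congrArg AlgHom.toLinearMap hl)
  · have h : LinearMap.mul' R A ∘ₗ r.toLinearMap.lTensor A =
        (Algebra.TensorProduct.productMap (.id R A) r).toLinearMap :=
      TensorProduct.ext' fun _ _ => rfl
    exact (congrArg (· ∘ₗ Δ.toLinearMap) h).trans (congrArg AlgHom.toLinearMap hr)

/-! ### Counit laws and coassociativity on forests -/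

namespace RootedTree

variable {T : RootedTree.{0}}

theorem numVertices_mk_branch_le {S : Finset T} {r : T} (hr : r ∈ S) :
    (RootedTreeClass.mk (branch S r)).numVertices ≤ S.card := by
  change Nat.card (branch S r) ≤ _
  rw [Nat.card_congr (branchIso S r).toEquiv, ← Nat.card_eq_finsetCard]
  exact Nat.card_le_card_of_injective
    (fun y => (⟨y, y.2.elim (fun h => h.symm ▸ hr) And.right⟩ : S))
    fun x y h => Subtype.ext (congrArg (Subtype.val (p := (· ∈ S))) h)

/-- Each component of a forest has at most as many vertices as the forest; this makes the antipode
recursion well-founded. -/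
theorem aeval_forestMonomial_congr {f g : RootedTreeClass → RootedTreeAlgebra} {n : ℕ}
    (h : ∀ t : RootedTreeClass, t.numVertices < n → f t = g t) {S : Finset T} (hS : S.card < n) :
    MvPolynomial.aeval (R := ℚ) f (forestMonomial S) =
      MvPolynomial.aeval (R := ℚ) g (forestMonomial S) := by
  classical
  unfold forestMonomial
  simp only [map_prod, MvPolynomial.aeval_X]
  exact Finset.prod_congr rfl fun r hr =>
    h _ ((numVertices_mk_branch_le (Finset.mem_filter.1 hr).1).trans_lt hS)

theorem counit_forestMonomial {S : Finset T} (hS : S.Nonempty) :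
    RootedTreeAlgebra.counit (forestMonomial S) = 0 := by
  obtain ⟨r, A, B, hA, hAB, _, rfl⟩ := exists_union_isLeast hS
  rw [forestMonomial_union hAB, map_mul, forestMonomial_of_isLeast hA, RootedTreeAlgebra.counit,
    MvPolynomial.aeval_X, zero_mul]

theorem empty_mem_subforests (S : Finset T) : ∅ ∈ subforests S :=
  mem_subforests.2 ⟨Finset.empty_subset S, by simp⟩

theorem self_mem_subforests (S : Finset T) : S ∈ subforests S :=
  mem_subforests.2 ⟨Finset.Subset.refl S, fun _ _ _ hy _ => hy⟩

theorem counit_left_forestCoproduct (S : Finset T) :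
    Algebra.TensorProduct.map RootedTreeAlgebra.counit (.id ℚ RootedTreeAlgebra)
      (forestCoproduct S) = 1 ⊗ₜ forestMonomial S := by
  classical
  unfold forestCoproduct
  rw [map_sum, Finset.sum_eq_single_of_mem ∅ (empty_mem_subforests S)]
  · simp
  · intro U _ hU
    rw [Algebra.TensorProduct.map_tmul,
      counit_forestMonomial (Finset.nonempty_iff_ne_empty.2 hU), TensorProduct.zero_tmul]

theorem counit_right_forestCoproduct (S : Finset T) :
    Algebra.TensorProduct.map (.id ℚ RootedTreeAlgebra) RootedTreeAlgebra.counit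
      (forestCoproduct S) = forestMonomial S ⊗ₜ 1 := by
  classical
  unfold forestCoproduct
  rw [map_sum, Finset.sum_eq_single_of_mem S (self_mem_subforests S)]
  · simp
  · intro U hU hUS
    have hU' := (mem_subforests.1 hU).1
    rw [Algebra.TensorProduct.map_tmul, counit_forestMonomial, TensorProduct.tmul_zero]
    exact Finset.sdiff_nonempty.2 fun h => hUS (hU'.antisymm h)

-- Nested subforests `U ⊆ F` correspond to pairs `(U, V)` through `V = F \ U` and `F = U ∪ V`. This
-- is coassociativity in combinatorial form.
open Classical in
theorem sum_subforests_subforests {M : Type*} [AddCommMonoid M] (S : Finset T)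
    (φ : Finset T → Finset T → Finset T → M) :
    ∑ F ∈ subforests S, ∑ U ∈ subforests F, φ U (F \ U) (S \ F) =
      ∑ U ∈ subforests S, ∑ V ∈ subforests (S \ U), φ U V ((S \ U) \ V) := by
  rw [Finset.sum_sigma', Finset.sum_sigma']
  refine Finset.sum_bij' (fun p _ => ⟨p.2, p.1 \ p.2⟩) (fun p _ => ⟨p.1 ∪ p.2, p.1⟩) ?_ ?_ ?_ ?_ ?_
  · rintro ⟨F, U⟩ h
    obtain ⟨hF, hU⟩ := Finset.mem_sigma.1 h
    obtain ⟨hFS, hF⟩ := mem_subforests.1 hF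
    obtain ⟨hUF, hU⟩ := mem_subforests.1 hU
    refine Finset.mem_sigma.2 ⟨mem_subforests.2 ⟨hUF.trans hFS, fun x hx y hy hxy =>
      hU x hx y (hF x (hUF hx) y hy hxy) hxy⟩, mem_subforests.2
        ⟨Finset.sdiff_subset_sdiff hFS subset_rfl, fun x hx y hy hxy => ?_⟩⟩
    obtain ⟨hyS, hyU⟩ := Finset.mem_sdiff.1 hy
    exact Finset.mem_sdiff.2 ⟨hF x (Finset.mem_sdiff.1 hx).1 y hyS hxy, hyU⟩
  · rintro ⟨U, V⟩ h
    obtain ⟨hU, hV⟩ := Finset.mem_sigma.1 h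
    obtain ⟨hUS, hU⟩ := mem_subforests.1 hU
    obtain ⟨hVS, hV⟩ := mem_subforests.1 hV
    refine Finset.mem_sigma.2 ⟨mem_subforests.2
      ⟨Finset.union_subset hUS (hVS.trans Finset.sdiff_subset), fun x hx y hy hxy => ?_⟩,
      mem_subforests.2 ⟨Finset.subset_union_left, fun x hx y hy hxy => ?_⟩⟩
    · by_cases hyU : y ∈ U
      · exact Finset.mem_union_left _ hyU
      · rcases Finset.mem_union.1 hx with hx | hx
        · exact absurd (hU x hx y hy hxy) hyU
        · exact Finset.mem_union_right _ (hV x hx y (Finset.mem_sdiff.2 ⟨hy, hyU⟩) hxy)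
    · exact hU x hx y (Finset.union_subset hUS (hVS.trans Finset.sdiff_subset) hy) hxy
  · rintro ⟨F, U⟩ h
    have hUF := (mem_subforests.1 (Finset.mem_sigma.1 h).2).1
    simp [Finset.union_sdiff_of_subset hUF]
  · rintro ⟨U, V⟩ h
    have hd : Disjoint V U := (Finset.subset_sdiff.1
      (mem_subforests.1 (Finset.mem_sigma.1 h).2).1).2
    simp [Finset.union_sdiff_cancel_left hd.symm]
  · rintro ⟨F, U⟩ h
    have hUF := (mem_subforests.1 (Finset.mem_sigma.1 h).2).1
    simp [sdiff_sdiff_left, Finset.union_eq_right.2 hUF]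

theorem coassoc_forestCoproduct (S : Finset T) :
    Algebra.TensorProduct.assoc ℚ ℚ ℚ RootedTreeAlgebra RootedTreeAlgebra RootedTreeAlgebra
      (Algebra.TensorProduct.map RootedTreeAlgebra.comul (.id ℚ RootedTreeAlgebra)
        (forestCoproduct S)) =
      Algebra.TensorProduct.map (.id ℚ RootedTreeAlgebra) RootedTreeAlgebra.comul
        (forestCoproduct S) := by
  classical
  have h := sum_subforests_subforests S fun U V W : Finset T =>
    forestMonomial U ⊗ₜ[ℚ] (forestMonomial V ⊗ₜ[ℚ] forestMonomial W)
  rw [forestCoproduct]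
  simp only [map_sum, Algebra.TensorProduct.map_tmul, comul_forestMonomial, AlgHom.id_apply]
  simp only [forestCoproduct, TensorProduct.sum_tmul, TensorProduct.tmul_sum, map_sum,
    Algebra.TensorProduct.assoc_tmul]
  exact h

end RootedTree

/-! ### One-sided antipodes -/

namespace RootedTreeClass

theorem induction_on {p : RootedTreeClass → Prop} (t : RootedTreeClass)
    (h : ∀ (T : RootedTree.{0}) [Fintype T], p (mk T)) : p t := by
  induction t using Quotient.inductionOn with
  | h T =>
    have := T.2
    have := Fintype.ofFinite T.1
    exact h T.1

theorem numVertices_mk (T : RootedTree.{0}) [Fintype T] :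
    (mk T).numVertices = (Finset.univ : Finset T).card :=
  Nat.card_eq_fintype_card

end RootedTreeClass

namespace RootedTreeAlgebra

open RootedTree

theorem exists_left_antipode : ∃ S : RootedTreeAlgebra →ₐ[ℚ] RootedTreeAlgebra,
    (Algebra.TensorProduct.productMap S (.id ℚ RootedTreeAlgebra)).comp comul =
      (Algebra.ofId ℚ RootedTreeAlgebra).comp counit := by
  classical
  -- A fixed point is exactly an `f` whose convolution with the identity vanishes on every tree. The
  -- term of the full subforest is `f t ⊗ 1`, which cancels the leading `f t`; the other terms
  -- involve `f` only on smaller trees.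
  obtain ⟨f, hf⟩ := exists_fixedPoint_of_local RootedTreeClass.numVertices
    (fun (f : RootedTreeClass → RootedTreeAlgebra) t => f t -
      Algebra.TensorProduct.productMap (MvPolynomial.aeval (R := ℚ) f) (.id ℚ RootedTreeAlgebra)
        (comul (MvPolynomial.X t))) fun f g t h => by
      induction t using RootedTreeClass.induction_on with
      | h T =>
        rw [comul_X_mk, forestCoproduct, map_sum, map_sum,
          ← Finset.add_sum_erase _ _ (self_mem_subforests _),
          ← Finset.add_sum_erase _ _ (self_mem_subforests _)]
        simp only [Algebra.TensorProduct.productMap_apply_tmul, Finset.sdiff_self,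
          forestMonomial_empty, map_one, mul_one, forestMonomial_univ, MvPolynomial.aeval_X,
          sub_add_cancel_left]
        refine congrArg _ (Finset.sum_congr rfl fun U hU => ?_)
        rw [aeval_forestMonomial_congr h]
        rw [RootedTreeClass.numVertices_mk]
        exact Finset.card_lt_card (Finset.ssubset_univ_iff.2 (Finset.ne_of_mem_erase hU))
  refine ⟨MvPolynomial.aeval f, MvPolynomial.algHom_ext fun t => ?_⟩
  simpa [counit] using sub_eq_self.1 (hf t).symm

theorem exists_right_antipode : ∃ S : RootedTreeAlgebra →ₐ[ℚ] RootedTreeAlgebra,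
    (Algebra.TensorProduct.productMap (.id ℚ RootedTreeAlgebra) S).comp comul =
      (Algebra.ofId ℚ RootedTreeAlgebra).comp counit := by
  classical
  -- Here the empty subforest contributes the cancelling `f t`, and the other terms evaluate `f` on
  -- proper quotients.
  obtain ⟨f, hf⟩ := exists_fixedPoint_of_local RootedTreeClass.numVertices
    (fun (f : RootedTreeClass → RootedTreeAlgebra) t => f t -
      Algebra.TensorProduct.productMap (.id ℚ RootedTreeAlgebra) (MvPolynomial.aeval (R := ℚ) f)
        (comul (MvPolynomial.X t))) fun f g t h => by
      induction t using RootedTreeClass.induction_on with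
      | h T =>
        rw [comul_X_mk, forestCoproduct, map_sum, map_sum,
          ← Finset.add_sum_erase _ _ (empty_mem_subforests _),
          ← Finset.add_sum_erase _ _ (empty_mem_subforests _)]
        simp only [Algebra.TensorProduct.productMap_apply_tmul, Finset.sdiff_empty,
          forestMonomial_empty, map_one, one_mul, forestMonomial_univ, MvPolynomial.aeval_X,
          sub_add_cancel_left]
        refine congrArg _ (Finset.sum_congr rfl fun U hU => ?_)
        rw [aeval_forestMonomial_congr h]
        rw [RootedTreeClass.numVertices_mk]
        exact Finset.card_lt_card (Finset.sdiff_ssubset (Finset.subset_univ U)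
          (Finset.nonempty_iff_ne_empty.2 (Finset.ne_of_mem_erase hU)))
  refine ⟨MvPolynomial.aeval f, MvPolynomial.algHom_ext fun t => ?_⟩
  simpa [counit] using sub_eq_self.1 (hf t).symm

end RootedTreeAlgebra

/-! ### The grading by number of vertices -/

namespace RootedTree

variable {T : RootedTree.{0}}

theorem forestMonomial_mem_degree (S : Finset T) :
    forestMonomial S ∈ RootedTreeAlgebra.degree S.card := by
  classical
  induction S using Finset.strongInduction with
  | H S ih =>
    rcases S.eq_empty_or_nonempty with rfl | hS
    · exact forestMonomial_empty (T := T) ▸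
        MvPolynomial.isWeightedHomogeneous_one ℚ RootedTreeClass.numVertices
    · obtain ⟨r, A, B, hA, hAB, hB, rfl⟩ := exists_union_isLeast hS
      have hd : Disjoint A B := Finset.disjoint_left.2 fun x hx hx' => (hAB x hx x hx').1 le_rfl
      have hcard : (RootedTreeClass.mk (branch A r)).numVertices = A.card := by
        change Nat.card (branch A r) = _
        rw [Nat.card_congr (branchIso A r).toEquiv, ← Nat.card_eq_finsetCard]
        exact Nat.card_congr (Equiv.subtypeEquivRight fun y =>
          ⟨fun h => h.elim (fun h => h.symm ▸ hA.1) And.right, fun h => Or.inr ⟨hA.2 h, h⟩⟩)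
      rw [forestMonomial_union hAB, forestMonomial_of_isLeast hA, Finset.card_union_of_disjoint hd,
        ← hcard]
      exact (MvPolynomial.isWeightedHomogeneous_X ℚ RootedTreeClass.numVertices _).mul (ih B hB)

end RootedTree

namespace RootedTreeAlgebra

open RootedTree

/-- The part of total degree `n` of the tensor square. -/
def tensorDegree (n : ℕ) : Submodule ℚ (RootedTreeAlgebra ⊗[ℚ] RootedTreeAlgebra) :=
  ⨆ (p : ℕ) (q : ℕ) (_ : p + q = n),
    LinearMap.range (TensorProduct.mapIncl (degree p) (degree q))

theorem tmul_mem_tensorDegree {p q : ℕ} {a b : RootedTreeAlgebra} (ha : a ∈ degree p)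
    (hb : b ∈ degree q) : a ⊗ₜ[ℚ] b ∈ tensorDegree (p + q) :=
  Submodule.mem_iSup_of_mem p <| Submodule.mem_iSup_of_mem q <| Submodule.mem_iSup_of_mem rfl
    ⟨⟨a, ha⟩ ⊗ₜ ⟨b, hb⟩, rfl⟩

theorem tensorDegree_induction {n : ℕ} {P : RootedTreeAlgebra ⊗[ℚ] RootedTreeAlgebra → Prop}
    (zero : P 0) (add : ∀ x y, P x → P y → P (x + y))
    (tmul : ∀ p q a b, p + q = n → a ∈ degree p → b ∈ degree q → P (a ⊗ₜ b))
    {x : RootedTreeAlgebra ⊗[ℚ] RootedTreeAlgebra} (hx : x ∈ tensorDegree n) : P x := by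
  unfold tensorDegree at hx
  induction hx using Submodule.iSup_induction' with
  | zero => exact zero
  | add x y _ _ hx hy => exact add x y hx hy
  | mem p x hx =>
    induction hx using Submodule.iSup_induction' with
    | zero => exact zero
    | add x y _ _ hx hy => exact add x y hx hy
    | mem q x hx =>
      induction hx using Submodule.iSup_induction' with
      | zero => exact zero
      | add x y _ _ hx hy => exact add x y hx hy
      | mem hpq x hx =>
        obtain ⟨z, rfl⟩ := hx
        induction z with
        | zero => simpa using zero
        | add x y hx hy => simpa using add _ _ hx hy
        | tmul a b => exact tmul p q a b hpq a.2 b.2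

theorem mul_mem_degree {p q : ℕ} {a b : RootedTreeAlgebra} (ha : a ∈ degree p)
    (hb : b ∈ degree q) : a * b ∈ degree (p + q) :=
  MvPolynomial.IsWeightedHomogeneous.mul ha hb

theorem mul_mem_tensorDegree {m n : ℕ} {x y : RootedTreeAlgebra ⊗[ℚ] RootedTreeAlgebra}
    (hx : x ∈ tensorDegree m) (hy : y ∈ tensorDegree n) : x * y ∈ tensorDegree (m + n) := by
  refine tensorDegree_induction (P := fun x => x * y ∈ tensorDegree (m + n)) (by simp)
    (fun x x' hx hx' => by simpa only [add_mul] using add_mem hx hx')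
    (fun p q a b hpq ha hb => ?_) hx
  refine tensorDegree_induction (P := fun y => a ⊗ₜ b * y ∈ tensorDegree (m + n)) (by simp)
    (fun y y' hy hy' => by simpa only [mul_add] using add_mem hy hy')
    (fun p' q' a' b' hpq' ha' hb' => ?_) hy
  rw [Algebra.TensorProduct.tmul_mul_tmul, ← hpq, ← hpq', add_add_add_comm]
  exact tmul_mem_tensorDegree (mul_mem_degree ha ha') (mul_mem_degree hb hb')

theorem one_mem_tensorDegree : (1 : RootedTreeAlgebra ⊗[ℚ] RootedTreeAlgebra) ∈ tensorDegree 0 :=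
  tmul_mem_tensorDegree (p := 0) (q := 0) (MvPolynomial.isWeightedHomogeneous_one _ _)
    (MvPolynomial.isWeightedHomogeneous_one _ _)

theorem comul_X_mem_tensorDegree (t : RootedTreeClass) :
    comul (MvPolynomial.X t) ∈ tensorDegree t.numVertices := by
  classical
  induction t using RootedTreeClass.induction_on with
  | h T =>
    rw [comul_X_mk, RootedTreeClass.numVertices_mk]
    refine sum_mem fun U _ => ?_
    -- The vertices of `T` are shared out between `U` and its complement, so the degrees add up.
    rw [← Finset.card_sdiff_add_card_eq_card (Finset.subset_univ U), add_comm]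
    exact tmul_mem_tensorDegree (forestMonomial_mem_degree _) (forestMonomial_mem_degree _)

theorem comul_monomial_mem_tensorDegree (d : RootedTreeClass →₀ ℕ) :
    comul (MvPolynomial.monomial d 1) ∈
      tensorDegree (Finsupp.weight RootedTreeClass.numVertices d) := by
  induction d using Finsupp.induction_linear with
  | zero => simpa using one_mem_tensorDegree
  | add d e hd he =>
    rw [← mul_one (1 : ℚ), ← MvPolynomial.monomial_mul, map_mul, map_add]
    exact mul_mem_tensorDegree hd he
  | single t n =>
    rw [← MvPolynomial.X_pow_eq_monomial, map_pow, Finsupp.weight_single]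
    induction n with
    | zero => simpa using one_mem_tensorDegree
    | succ n ih =>
      rw [pow_succ, succ_nsmul]
      exact mul_mem_tensorDegree ih (comul_X_mem_tensorDegree t)

theorem comul_mem_tensorDegree {n : ℕ} {a : RootedTreeAlgebra} (ha : a ∈ degree n) :
    comul a ∈ tensorDegree n := by
  induction ha using MvPolynomial.IsWeightedHomogeneous.induction_on with
  | zero => simp
  | add p q _ _ hp hq => simpa using add_mem hp hq
  | monomial d r hr =>
    rw [← mul_one r, ← smul_eq_mul, ← MvPolynomial.smul_monomial, map_smul]
    exact Submodule.smul_mem _ _ (hr ▸ comul_monomial_mem_tensorDegree d)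

theorem numVertices_ne_zero (t : RootedTreeClass) : t.numVertices ≠ 0 := by
  induction t using RootedTreeClass.induction_on with
  | h T => simp [RootedTreeClass.numVertices_mk]

/-- All variables have positive weight, so only constants have weight 0. -/
theorem degree_zero : degree 0 = LinearMap.range (Algebra.linearMap ℚ RootedTreeAlgebra) := by
  ext a
  constructor
  · intro ha
    have h := MvPolynomial.weightedHomogeneousComponent_zero a numVertices_ne_zero
    rw [MvPolynomial.IsWeightedHomogeneous.weightedHomogeneousComponent_same ha] at h
    exact ⟨_, h.symm⟩
  · rintro ⟨c, rfl⟩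
    exact MvPolynomial.isWeightedHomogeneous_C _ c

theorem isConnectedGrading : IsConnectedGrading comul degree where
  isInternal := by
    classical
    let _ := MvPolynomial.weightedDecomposition ℚ RootedTreeClass.numVertices
    exact DirectSum.Decomposition.isInternal
      (MvPolynomial.weightedHomogeneousSubmodule ℚ RootedTreeClass.numVertices)
  mul_mem := fun _ _ _ ha _ hb => mul_mem_degree ha hb
  comul_mem := fun _ _ ha => comul_mem_tensorDegree ha
  zero_eq := degree_zero

/-! ### The bialgebra axioms and the Hopf algebra -/

theorem comul_coassoc :
    (Algebra.TensorProduct.assoc ℚ ℚ ℚ RootedTreeAlgebra RootedTreeAlgebra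
        RootedTreeAlgebra).toAlgHom.comp
      ((Algebra.TensorProduct.map comul (.id ℚ RootedTreeAlgebra)).comp comul) =
    (Algebra.TensorProduct.map (.id ℚ RootedTreeAlgebra) comul).comp comul := by
  refine MvPolynomial.algHom_ext fun t => ?_
  induction t using RootedTreeClass.induction_on with
  | h T =>
    simp only [AlgHom.comp_apply, comul_X_mk]
    exact coassoc_forestCoproduct _

theorem counit_comul_left :
    (Algebra.TensorProduct.map counit (.id ℚ RootedTreeAlgebra)).comp comul =
      (Algebra.TensorProduct.lid ℚ RootedTreeAlgebra).symm := by
  refine MvPolynomial.algHom_ext fun t => ?_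
  induction t using RootedTreeClass.induction_on with
  | h T =>
    rw [AlgHom.comp_apply, comul_X_mk, counit_left_forestCoproduct, forestMonomial_univ]
    rfl

theorem counit_comul_right :
    (Algebra.TensorProduct.map (.id ℚ RootedTreeAlgebra) counit).comp comul =
      (Algebra.TensorProduct.rid ℚ ℚ RootedTreeAlgebra).symm := by
  refine MvPolynomial.algHom_ext fun t => ?_
  induction t using RootedTreeClass.induction_on with
  | h T =>
    rw [AlgHom.comp_apply, comul_X_mk, counit_right_forestCoproduct, forestMonomial_univ]
    rfl

theorem exists_hopfAlgebra :
    ∃ H : HopfAlgebra ℚ RootedTreeAlgebra, H.toHopfAlgebraStruct.toBialgebra =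
      Bialgebra.ofAlgHom comul counit comul_coassoc counit_comul_left counit_comul_right := by
  obtain ⟨l, hl⟩ := exists_left_antipode
  obtain ⟨r, hr⟩ := exists_right_antipode
  exact Bialgebra.exists_hopfAlgebra_ofAlgHom comul counit _ _ _ l r hl hr

end RootedTreeAlgebra
end

/-- With `Δ(T) = ∑ F ⊗ T/F` and `ε(T) = 0` on trees, `ℚ[𝒯]` is a Hopf algebra, and the number of
vertices is a connected grading of it. The first three items are coassociativity and the counit
laws; the fourth is a Hopf algebra whose underlying bialgebra is `(ℚ[𝒯], Δ, ε)`. -/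
theorem theorem4p2 :
    ∃ (h_coassoc :
        (Algebra.TensorProduct.assoc ℚ ℚ ℚ RootedTreeAlgebra RootedTreeAlgebra
            RootedTreeAlgebra).toAlgHom.comp
          ((Algebra.TensorProduct.map RootedTreeAlgebra.comul (.id ℚ RootedTreeAlgebra)).comp
            RootedTreeAlgebra.comul) =
        (Algebra.TensorProduct.map (.id ℚ RootedTreeAlgebra) RootedTreeAlgebra.comul).comp
          RootedTreeAlgebra.comul)
      (h_counit_left :
        (Algebra.TensorProduct.map RootedTreeAlgebra.counit (.id ℚ RootedTreeAlgebra)).comp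
          RootedTreeAlgebra.comul = (Algebra.TensorProduct.lid ℚ RootedTreeAlgebra).symm)
      (h_counit_right :
        (Algebra.TensorProduct.map (.id ℚ RootedTreeAlgebra) RootedTreeAlgebra.counit).comp
          RootedTreeAlgebra.comul = (Algebra.TensorProduct.rid ℚ ℚ RootedTreeAlgebra).symm)
      (hopf : HopfAlgebra ℚ RootedTreeAlgebra),
      hopf.toHopfAlgebraStruct.toBialgebra =
        Bialgebra.ofAlgHom RootedTreeAlgebra.comul RootedTreeAlgebra.counit
          h_coassoc h_counit_left h_counit_right ∧
      IsConnectedGrading RootedTreeAlgebra.comul RootedTreeAlgebra.degree := by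
  exact ⟨RootedTreeAlgebra.comul_coassoc, RootedTreeAlgebra.counit_comul_left,
    RootedTreeAlgebra.counit_comul_right, RootedTreeAlgebra.exists_hopfAlgebra.choose,
    RootedTreeAlgebra.exists_hopfAlgebra.choose_spec, RootedTreeAlgebra.isConnectedGrading⟩
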